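/- All Lie algebras are finite dimensional over $\mathbb{C}$, and for subspaces $U,W$ of a Lie algebra $[U,W]$ denotes the linear span of all $[u,w]$, $u\in U$, $w\in W$. A Lie algebra $\mathfrak g$ is perfect if $[\mathfrak g,\mathfrak g]=\mathfrak g$; it is sympathetic if it is perfect, $Z(\mathfrak g)=0$, and every derivation of $\mathfrak g$ is inner. A derivation that is not inner is called outer. Let $\mathfrak g=\mathfrak g_L\ltimes\mathfrak h$, where $\mathfrak h=\operatorname{Rad}(\mathfrak g)$ and $\mathfrak g_L$ is a simple Levi subalgebra, and suppose that $\mathfrak h=V_1\oplus V_2\oplus V_3\oplus V_4$ with simple $\mathfrak g_L$-submodules $V_i$ such that every product $[V_i,V_j]$ $(1\le i,j\le 4)$ is either $0$ or equal to one of $V_1,\dots,V_4$. (a) If $\mathfrak g$ is sympathetic, then the four modules can be relabelled $V_n,V_m,V_p,V_k$ in such a way that $[\mathfrak h,\mathfrak h]=V_p\oplus V_k$, $Z(\mathfrak h)=V_k$, and the products are given by one of the following six tables, in which $[V_n,V_p]=V_k$, $[V_p,V_p]=0$, $[V_k,\mathfrak h]=0$ and $$\begin{array}{c|cccc} & [V_n,V_n]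 & [V_n,V_m] & [V_m,V_m] & [V_m,V_p]\\ \hline 1 & V_p & V_p & V_k & V_k\\ 2 & V_k & V_p & 0 & V_k\\ 3 & V_k & V_p & V_k & V_k\\ 4 & V_p & V_p & V_k & 0\\ 5 & V_k & V_p & V_k & 0\\ 6 & V_p & V_k & V_k & 0 \end{array}$$ (b) Suppose that $\mathfrak g$ is perfect, and that for some labelling $V_n,V_m,V_p,V_k$ of the four modules the products are given by one of the following tables, again with $[V_n,V_p]=V_k$, $[V_p,V_p]=0$ and $[V_k,\mathfrak h]=0$ (an entry $X/Y$ means that either $X$ or $Y$ may occur): $$\begin{array}{cccc|c} [V_n,V_n] & [V_n,V_m] & [V_m,V_m] & [V_m,V_p] & (c_n,c_m,c_p,c_k)\\ \hline V_m & V_p & V_k/0 & 0 & (\tfrac14,\tfrac12,\tfrac34,1)\\ V_p/0 & V_p & V_p/0 & V_k & (\tfrac12,\tfrac12,1,\tfrac32)\\ V_p & V_p & 0 & 0 & (\tfrac12,\tfrac12,1,\tfrac32)\\ V_k/0 & V_p & 0 & 0 & (\tfrac12,0,\tfrac12,1)\\ 0 & V_p & V_k & 0 & (\tfrac14,\tfrac12,\tfrac34,1)\\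 V_p & 0 & V_k & 0 & (\tfrac12,\tfrac34,1,\tfrac32)\\ V_p & V_k & 0 & 0 & (\tfrac12,1,1,\tfrac32) \end{array}$$ Then for every $\lambda\in\mathbb{C}\setminus\{0\}$ the linear map $D$ with $D|_{\mathfrak g_L}=0$ and $D|_{V_i}=\lambda c_i\operatorname{Id}_{V_i}$ for $i\in\{n,m,p,k\}$ is an outer derivation of $\mathfrak g$. -/

import Mathlib

namespace Sympathetic

/-- A Lie algebra is perfect if it equals its derived algebra. -/
def IsPerfect (L : Type*) [LieRing L] [LieAlgebra ℂ L] : Prop :=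
  ⁅(⊤ : LieIdeal ℂ L), (⊤ : LieIdeal ℂ L)⁆ = ⊤

/-- A derivation is inner if it is `ad x` for some `x`; otherwise it is outer. -/
def IsInner {L : Type*} [LieRing L] [LieAlgebra ℂ L] (D : LieDerivation ℂ L L) : Prop :=
  ∃ x : L, ∀ y : L, D y = ⁅x, y⁆

/-- A Lie algebra is sympathetic if it has trivial centre, is perfect, and all its derivations
are inner. -/
structure IsSympathetic (L : Type*) [LieRing L] [LieAlgebra ℂ L] : Prop where
  center_eq_bot : LieAlgebra.center ℂ L = ⊥
  perfect : IsPerfect L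
  inner : ∀ D : LieDerivation ℂ L L, IsInner D

/-- The product `[U, W]` of two subspaces: the linear span of all `[u, w]`. -/
def brac {L : Type*} [LieRing L] [LieAlgebra ℂ L] (U W : Submodule ℂ L) : Submodule ℂ L :=
  Submodule.span ℂ {z | ∃ u ∈ U, ∃ w ∈ W, ⁅u, w⁆ = z}

/-- The centre of an ideal, as a Lie algebra in its own right, viewed as a subspace of the
ambient Lie algebra. -/
def centerOf {L : Type*} [LieRing L] [LieAlgebra ℂ L] (I : LieIdeal ℂ L) : Submodule ℂ L :=
  (LieAlgebra.center ℂ I).toSubmodule.map I.toSubmodule.subtype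

/-- A multiplication table for four subspaces `V 0, V 1, V 2, V 3`, which play the roles of
`V_n, V_m, V_p, V_k` in this order. An entry `some l` stands for `V l`, an entry `none` for `0`. -/
abbrev MultTable : Type := Matrix (Fin 4) (Fin 4) (Option (Fin 4))

/-- The subspace that a table entry stands for. -/
def entry {L : Type*} [AddCommGroup L] [Module ℂ L] (V : Fin 4 → Submodule ℂ L) :
    Option (Fin 4) → Submodule ℂ L
  | none => ⊥
  | some l => V l

/-- The products of the subspaces `V i` are those prescribed by the table `T`. -/
def HasTable {L : Type*} [LieRing L] [LieAlgebra ℂ L] (V : Fin 4 → Submodule ℂ L)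
    (T : MultTable) : Prop :=
  ∀ i j : Fin 4, brac (V i) (V j) = entry V (T i j)

/-- The table entry `0`. -/
abbrev o : Option (Fin 4) := none
/-- The table entry `V_m`. -/
abbrev m : Option (Fin 4) := some 1
/-- The table entry `V_p`. -/
abbrev p : Option (Fin 4) := some 2
/-- The table entry `V_k`. -/
abbrev k : Option (Fin 4) := some 3

/-- The six tables. -/
def sixTables : Fin 6 → MultTable :=
  ![!![p, p, k, o;
       p, k, k, o;
       k, k, o, o;
       o, o, o, o],
    !![k, p, k, o;
       p, o, k, o;
       k, k, o, o;
       o, o, o, o],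
    !![k, p, k, o;
       p, k, k, o;
       k, k, o, o;
       o, o, o, o],
    !![p, p, k, o;
       p, k, o, o;
       k, o, o, o;
       o, o, o, o],
    !![k, p, k, o;
       p, k, o, o;
       k, o, o, o;
       o, o, o, o],
    !![p, k, k, o;
       k, k, o, o;
       k, o, o, o;
       o, o, o, o]]

/-- The other tables, each with the weights `c 0, c 1, c 2, c 3` of the derivation that acts by
`0` on the Levi subalgebra and by the scalar `c i` on `V i`. The letters `a`, `b` stand for the
entries of the table for which there are several possibilities. -/
inductive OtherTable : MultTable → (Fin 4 → ℂ) → Prop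
  | threeModules (b : Option (Fin 4)) (hb : b = k ∨ b = o) :
      OtherTable
        !![m, p, k, o;
           p, b, o, o;
           k, o, o, o;
           o, o, o, o] ![1 / 4, 1 / 2, 3 / 4, 1]
  | first (a b : Option (Fin 4)) (ha : a = p ∨ a = o) (hb : b = p ∨ b = o) :
      OtherTable
        !![a, p, k, o;
           p, b, k, o;
           k, k, o, o;
           o, o, o, o] ![1 / 2, 1 / 2, 1, 3 / 2]
  | secondA :
      OtherTable
        !![p, p, k, o;
           p, o, o, o;
           k, o, o, o;
           o, o, o, o] ![1 / 2, 1 / 2, 1, 3 / 2]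
  | secondB (a : Option (Fin 4)) (ha : a = k ∨ a = o) :
      OtherTable
        !![a, p, k, o;
           p, o, o, o;
           k, o, o, o;
           o, o, o, o] ![1 / 2, 0, 1 / 2, 1]
  | secondC :
      OtherTable
        !![o, p, k, o;
           p, k, o, o;
           k, o, o, o;
           o, o, o, o] ![1 / 4, 1 / 2, 3 / 4, 1]
  | third :
      OtherTable
        !![p, o, k, o;
           o, k, o, o;
           k, o, o, o;
           o, o, o, o] ![1 / 2, 3 / 4, 1, 3 / 2]
  | fourth :
      OtherTable
        !![p, k, k, o;
           k, o, o, o;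
           k, o, o, o;
           o, o, o, o] ![1 / 2, 1, 1, 3 / 2]

end Sympathetic

/-! In a perfect algebra the radical equals `[g, rad g]`. By Lie's theorem it acts on a simple
module by scalars, so these commutators act by zero. Hence an ideal `M` with `M ≤ [rad g, M]`
vanishes (`eq_bot_of_le_lie_radical`), and the summands can be ordered so that each nonzero product
comes strictly after its factors (`exists_perm_lt`).

Only finitely many tables are then left. The Jacobi identity constrains the table itself
(`HasTable.jacobiTable`), and enumeration shows that a table obeying it is one of the six up to
relabelling, or admits additive weights that are nonzero on the last summand
(`table_classification`). Such weights define a derivation (`exists_derivation`), which is outer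
(`not_isInner`) because the radical cannot map the last summand to itself; so a sympathetic algebra
has one of the six tables. Part (b) uses the same two lemmas with the listed weights. -/

namespace Sympathetic

/-! ### Combinatorics of multiplication tables -/

/-- The symmetric table with prescribed entries on and above the diagonal of its upper left
three by three block, and zeros in the last row and column. -/
def symmTable (a b c d e f : Option (Fin 4)) : MultTable :=
  !![a, b, c, o;
     b, d, e, o;
     c, e, f, o;
     o, o, o, o]

/-- Combinatorial form of the Jacobi identity for the products prescribed by a table. -/
def JacobiTable (T : MultTable) : Prop :=
  ∀ i j h l, ((T i j).bind fun a => T a h) = some l →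
    ((T i h).bind fun a => T a j) = some l ∨ ((T j h).bind fun a => T i a) = some l

instance (T : MultTable) : Decidable (JacobiTable T) := by
  unfold JacobiTable; infer_instance

/-- The weights `c` define a grading compatible with the table. -/
def IsGrading {R : Type*} [Add R] (T : MultTable) (c : Fin 4 → R) : Prop :=
  ∀ i j l, T i j = some l → c i + c j = c l

instance (T : MultTable) (c : Fin 4 → ℕ) : Decidable (IsGrading T c) := by
  unfold IsGrading; infer_instance

/-- The ranges of `a`, ..., `f` are the values that come strictly after both factors. Five weights
are those of `OtherTable` cleared of denominators; the others are permutations of these, or `![1, 1,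
1, 2]`, `![1, 1, 2, 2]`, `![1, 2, 1, 2]`. The permutations `τ` are needed because the ordering of
the summands need not be unique. -/
theorem symmTable_classification :
    ∀ a ∈ [o, m, p, k], ∀ b ∈ [o, p, k], ∀ c ∈ [o, k], ∀ d ∈ [o, p, k], ∀ e ∈ [o, k],
    ∀ f ∈ [o, k], JacobiTable (symmTable a b c d e f) →
      (∃ w ∈ ([![1, 1, 1, 2], ![1, 1, 2, 2], ![1, 1, 2, 3], ![1, 2, 3, 4], ![1, 2, 2, 3],
          ![1, 2, 1, 2], ![1, 0, 1, 2], ![0, 1, 1, 2], ![2, 1, 2, 3], ![2, 1, 3, 4],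
          ![2, 4, 3, 6], ![2, 3, 4, 6], ![3, 2, 4, 6]] : List (Fin 4 → ℕ)),
        w 3 ≠ 0 ∧ IsGrading (symmTable a b c d e f) w) ∨
      ∃ τ ∈ ([1, Equiv.swap 0 1, Equiv.swap 1 2] : List (Equiv.Perm (Fin 4))), ∃ t : Fin 6,
        ∀ i j, symmTable a b c d e f (τ i) (τ j) = (sixTables t i j).map τ := by
  decide +kernel

/-- A symmetric table satisfying the Jacobi identity in which every product comes strictly later
than its factors either has a nontrivial grading or is, up to relabelling, one of the six tables. -/
theorem table_classification (T : MultTable) (hsymm : ∀ i j, T i j = T j i)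
    (hjac : JacobiTable T) (hlt : ∀ i j l, T i j = some l → i < l ∧ j < l) :
    (∃ w : Fin 4 → ℕ, w 3 ≠ 0 ∧ IsGrading T w) ∨
      ∃ (τ : Equiv.Perm (Fin 4)) (t : Fin 6), ∀ i j, T (τ i) (τ j) = (sixTables t i j).map τ := by
  have key : ∀ (i j : Fin 4) (x : Option (Fin 4)), T i j = x →
      x = none ∨ ∃ l, x = some l ∧ i < l ∧ j < l := by
    rintro i j (_ | l) h
    · exact Or.inl rfl
    · exact Or.inr ⟨l, rfl, hlt i j l h⟩
  have last : ∀ i, T i 3 = none := fun i => by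
    rcases key i 3 _ rfl with h | ⟨l, -, -, h⟩
    · exact h
    · omega
  have hT : T = symmTable (T 0 0) (T 0 1) (T 0 2) (T 1 1) (T 1 2) (T 2 2) := by
    ext1 i j
    fin_cases i <;> fin_cases j <;>
      simp [symmTable, last, hsymm 1 0, hsymm 2 0, hsymm 2 1, hsymm 3]
  have m00 : T 0 0 ∈ [o, m, p, k] := by
    rcases key 0 0 _ rfl with h | ⟨l, h, h0, -⟩
    · simp [h]
    · rw [h]; fin_cases l <;> simp at h0 ⊢
  have m01 : T 0 1 ∈ [o, p, k] := by
    rcases key 0 1 _ rfl with h | ⟨l, h, -, h0⟩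
    · simp [h]
    · rw [h]; fin_cases l <;> simp at h0 ⊢
  have m02 : T 0 2 ∈ [o, k] := by
    rcases key 0 2 _ rfl with h | ⟨l, h, -, h0⟩
    · simp [h]
    · rw [h]; fin_cases l <;> simp at h0 ⊢
  have m11 : T 1 1 ∈ [o, p, k] := by
    rcases key 1 1 _ rfl with h | ⟨l, h, -, h0⟩
    · simp [h]
    · rw [h]; fin_cases l <;> simp at h0 ⊢
  have m12 : T 1 2 ∈ [o, k] := by
    rcases key 1 2 _ rfl with h | ⟨l, h, -, h0⟩
    · simp [h]
    · rw [h]; fin_cases l <;> simp at h0 ⊢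
  have m22 : T 2 2 ∈ [o, k] := by
    rcases key 2 2 _ rfl with h | ⟨l, h, -, h0⟩
    · simp [h]
    · rw [h]; fin_cases l <;> simp at h0 ⊢
  rw [hT] at hjac
  have := symmTable_classification _ m00 _ m01 _ m02 _ m11 _ m12 _ m22 hjac
  rw [← hT] at this
  rcases this with ⟨w, -, h⟩ | ⟨τ, -, t, h⟩
  · exact Or.inl ⟨w, h⟩
  · exact Or.inr ⟨τ, t, h⟩

/-- If every nonempty set of indices contains one that is not a product with a factor in the set,
then the indices can be ordered so that every product comes strictly later than its factors. -/
theorem exists_perm_lt (T : MultTable) (hsymm : ∀ i j, T i j = T j i)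
    (h : ∀ C : Finset (Fin 4), C.Nonempty → ∃ l ∈ C, ∀ i, ∀ j ∈ C, T i j ≠ some l) :
    ∃ σ : Equiv.Perm (Fin 4), ∀ i j l, T (σ i) (σ j) = some (σ l) → i < l ∧ j < l := by
  -- Greedy choice: each new index is not a product with a factor among the indices still remaining.
  obtain ⟨a, -, ha⟩ := h Finset.univ ⟨0, Finset.mem_univ _⟩
  obtain ⟨b, hb, hb'⟩ := h (Finset.univ \ {a}) (by
    rw [← Finset.card_pos, Finset.card_sdiff_of_subset (Finset.subset_univ _)]; simp)
  obtain ⟨c, hc, hc'⟩ := h (Finset.univ \ {a, b}) (by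
    rw [← Finset.card_pos, Finset.card_sdiff_of_subset (Finset.subset_univ _)]
    have := Finset.card_le_two (a := a) (b := b); simp; omega)
  obtain ⟨d, hd, hd'⟩ := h (Finset.univ \ {a, b, c}) (by
    rw [← Finset.card_pos, Finset.card_sdiff_of_subset (Finset.subset_univ _)]
    have := Finset.card_le_three (a := a) (b := b) (c := c); simp; omega)
  simp only [Finset.mem_sdiff, Finset.mem_univ, true_and, Finset.mem_insert,
    Finset.mem_singleton, not_or, forall_const] at ha hb hb' hc hc' hd hd'
  have hinj : Function.Injective ![a, b, c, d] := by
    intro i j hij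
    fin_cases i <;> fin_cases j <;> simp at hij ⊢ <;> grind
  let σ : Equiv.Perm (Fin 4) :=
    Equiv.ofBijective ![a, b, c, d] (Finite.injective_iff_bijective.mp hinj)
  have key : ∀ i j l, T (σ i) (σ j) = some (σ l) → j < l := by
    intro i j l hl
    by_contra hjl
    -- If `l ≤ j`, then `σ j` was still available when `σ l` was chosen.
    have hne : ∀ n < l, σ j ≠ σ n := fun n hn hjn => hjl (σ.injective hjn ▸ hn)
    fin_cases l
    · exact ha _ _ hl
    · exact hb' _ _ (hne 0 (by decide)) hl
    · exact hc' _ _ ⟨hne 0 (by decide), hne 1 (by decide)⟩ hl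
    · exact hd' _ _ ⟨hne 0 (by decide), hne 1 (by decide), hne 2 (by decide)⟩ hl
  exact ⟨σ, fun i j l hl => ⟨key j i l (by rw [hsymm]; exact hl), key i j l hl⟩⟩

/-! ### Products of subspaces -/

section Products

variable {L : Type*} [LieRing L] [LieAlgebra ℂ L]

/-- Gives access to the behaviour of `Submodule.map₂` on suprema and `⊥`. -/
theorem brac_eq_map₂ (U W : Submodule ℂ L) :
    brac U W = Submodule.map₂
      (LinearMap.mk₂ ℂ (fun x y : L => ⁅x, y⁆) add_lie smul_lie lie_add lie_smul) U W := by
  rw [Submodule.map₂_eq_span_image2]; rfl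

theorem lie_mem_brac {U W : Submodule ℂ L} {u w : L} (hu : u ∈ U) (hw : w ∈ W) :
    ⁅u, w⁆ ∈ brac U W :=
  Submodule.subset_span ⟨u, hu, w, hw, rfl⟩

theorem brac_le {U W X : Submodule ℂ L} : brac U W ≤ X ↔ ∀ u ∈ U, ∀ w ∈ W, ⁅u, w⁆ ∈ X := by
  rw [brac_eq_map₂, Submodule.map₂_le]; rfl

theorem brac_comm (U W : Submodule ℂ L) : brac U W = brac W U := by
  have key : ∀ U W : Submodule ℂ L, brac U W ≤ brac W U := fun U W =>
    brac_le.mpr fun u hu w hw => by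
      rw [← lie_skew]; exact neg_mem (lie_mem_brac hw hu)
  exact le_antisymm (key U W) (key W U)

theorem brac_brac_le (A B C : Submodule ℂ L) :
    brac (brac A B) C ≤ brac (brac A C) B ⊔ brac A (brac B C) := by
  refine brac_le.mpr fun u hu c hc => ?_
  induction hu using Submodule.span_induction with
  | zero => simp
  | add x y _ _ hx hy => rw [add_lie]; exact add_mem hx hy
  | smul r x _ hx => rw [smul_lie]; exact Submodule.smul_mem _ r hx
  | mem x h =>
    obtain ⟨a, ha, b, hb, rfl⟩ := h
    have e : ⁅⁅a, b⁆, c⁆ = ⁅⁅a, c⁆, b⁆ + ⁅a, ⁅b, c⁆⁆ := by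
      rw [lie_lie, ← lie_skew ⁅a, c⁆ b]; abel
    rw [e]
    exact Submodule.add_mem_sup (lie_mem_brac (lie_mem_brac ha hc) hb)
      (lie_mem_brac ha (lie_mem_brac hb hc))

theorem brac_bot_left (W : Submodule ℂ L) : brac ⊥ W = ⊥ := by
  rw [brac_eq_map₂, Submodule.map₂_bot_left]

theorem brac_bot_right (W : Submodule ℂ L) : brac W ⊥ = ⊥ := by
  rw [brac_eq_map₂, Submodule.map₂_bot_right]

theorem mem_centerOf {I : LieIdeal ℂ L} {z : L} :
    z ∈ centerOf I ↔ z ∈ I ∧ ∀ y ∈ I, ⁅z, y⁆ = 0 := by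
  constructor
  · rintro ⟨⟨x, hx⟩, hc, rfl⟩
    refine ⟨hx, fun y hy => ?_⟩
    have h := (LieModule.mem_maxTrivSubmodule (R := ℂ) (L := I) (M := I) _).mp hc ⟨y, hy⟩
    rw [← lie_skew, neg_eq_zero]
    exact congrArg Subtype.val h
  · rintro ⟨hz, h⟩
    refine ⟨⟨z, hz⟩, ?_, rfl⟩
    refine (LieModule.mem_maxTrivSubmodule (R := ℂ) (L := I) (M := I) _).mpr fun y => ?_
    apply Subtype.ext
    have := h y y.2
    rw [← lie_skew, neg_eq_zero] at this
    simpa using this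

end Products

/-! ### Nilpotent action of the radical of a perfect Lie algebra -/

section Perfect

variable {L : Type*} [LieRing L] [LieAlgebra ℂ L]

/-- On an irreducible module the ideal `[L, rad L]` acts by zero. -/
theorem lie_lie_radical_eq_zero_of_isIrreducible [FiniteDimensional ℂ L] {M : Type*} [AddCommGroup M] [Module ℂ M]
    [FiniteDimensional ℂ M] [LieRingModule L M] [LieModule ℂ L M]
    [LieModule.IsIrreducible ℂ L M] (x a : L) (ha : a ∈ LieAlgebra.radical ℂ L) (v : M) :
    ⁅⁅x, a⁆, v⁆ = 0 := by
  have : Nontrivial M := by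
    by_contra h
    rw [not_nontrivial_iff_subsingleton] at h
    exact bot_ne_top (α := LieSubmodule ℂ L M) (Subsingleton.elim _ _)
  -- Lie's theorem gives a weight `χ` of the radical. Its weight space is stable under all of `L`,
  -- hence is everything, and `a` acts by a scalar.
  obtain ⟨χ, hχ⟩ := LieModule.exists_nontrivial_weightSpace_of_isSolvable ℂ
    (LieAlgebra.radical ℂ L) M
  set W : LieSubmodule ℂ L M := LieModule.weightSpaceOfIsLieTower ℂ M χ with hW
  have hnt : Nontrivial W := hχ
  have htop : W = ⊤ := LieSubmodule.eq_top_of_isIrreducible ℂ L M W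
  have hact : ∀ w : M, ⁅a, w⁆ = χ ⟨a, ha⟩ • w := fun w => by
    have hw : w ∈ W := htop ▸ LieSubmodule.mem_top w
    exact (LieModule.mem_weightSpace _ _).mp hw ⟨a, ha⟩
  rw [lie_lie, hact, hact, lie_smul, sub_self]

/-- In a perfect Lie algebra, `rad L = [L, rad L]`. -/
theorem IsPerfect.lie_radical_eq (h : IsPerfect L) (S : LieSubalgebra ℂ L)
    (hS : IsCompl S.toSubmodule (LieAlgebra.radical ℂ L).toSubmodule) :
    ⁅(⊤ : LieIdeal ℂ L), LieAlgebra.radical ℂ L⁆ = LieAlgebra.radical ℂ L := by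
  set R := LieAlgebra.radical ℂ L
  refine le_antisymm (LieSubmodule.lie_le_right _ _) fun x hx => ?_
  -- Only brackets inside `S` escape `[L, R]`, and an element of `R` has no component in `S`.
  have hle : ∀ y : L, y ∈ S.toSubmodule ⊔ (⁅(⊤ : LieIdeal ℂ L), R⁆).toSubmodule := by
    intro y
    have hy : y ∈ ⁅(⊤ : LieIdeal ℂ L), (⊤ : LieIdeal ℂ L)⁆ := by rw [h]; trivial
    rw [← LieSubmodule.mem_toSubmodule, LieSubmodule.lieIdeal_oper_eq_linear_span'] at hy
    induction hy using Submodule.span_induction with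
    | zero => exact zero_mem _
    | add x y _ _ hx hy => exact add_mem hx hy
    | smul r x _ hx => exact Submodule.smul_mem _ r hx
    | mem z hz =>
      obtain ⟨a, -, b, -, rfl⟩ := hz
      have split : ∀ c : L, ∃ s ∈ S, ∃ r ∈ R, s + r = c := fun c => by
        have : c ∈ S.toSubmodule ⊔ R.toSubmodule := by rw [hS.sup_eq_top]; trivial
        exact Submodule.mem_sup.mp this
      obtain ⟨s, hs, r, hr, rfl⟩ := split a
      obtain ⟨s', hs', r', hr', rfl⟩ := split b
      have e : ⁅s + r, s' + r'⁆ = ⁅s, s'⁆ + (⁅s + r, r'⁆ - ⁅s', r⁆) := by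
        simp only [add_lie, lie_add, ← lie_skew s' r]; abel
      rw [e]
      exact Submodule.add_mem_sup (S.lie_mem hs hs')
        (sub_mem (LieSubmodule.lie_mem_lie trivial hr') (LieSubmodule.lie_mem_lie trivial hr))
  obtain ⟨s, hs, r, hr, rfl⟩ := Submodule.mem_sup.mp (hle x)
  have hrR : r ∈ R := LieSubmodule.lie_le_right R ⊤ hr
  have hs0 : s = 0 := by
    have : s ∈ R := by simpa using sub_mem hx hrR
    exact Submodule.disjoint_def.mp hS.disjoint s hs this
  simpa [hs0] using hr

/-- In a perfect Lie algebra the radical acts nilpotently: an ideal that is reproduced by the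
action of the radical vanishes. -/
theorem eq_bot_of_le_lie_radical [FiniteDimensional ℂ L]
    (hR : ⁅(⊤ : LieIdeal ℂ L), LieAlgebra.radical ℂ L⁆ = LieAlgebra.radical ℂ L)
    (M : LieIdeal ℂ L) (hM : M ≤ ⁅LieAlgebra.radical ℂ L, M⁆) : M = ⊥ := by
  by_contra hne
  have hnt : Nontrivial M := (LieSubmodule.nontrivial_iff_ne_bot ℂ L L).mpr hne
  have : Nontrivial (LieSubmodule ℂ L M) := inferInstance
  -- For a maximal submodule `N`, the radical kills the simple quotient `M ⧸ N`, so `[rad L, M]`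
  -- lies in `N`, which is proper.
  obtain ⟨N, hN⟩ := IsCoatomic.exists_coatom (LieSubmodule ℂ L M)
  have hirr : LieModule.IsIrreducible ℂ L (M ⧸ N) := by
    have : Nontrivial (M ⧸ N) := by
      obtain ⟨v, -, hv⟩ := SetLike.exists_of_lt hN.lt_top
      exact ⟨LieSubmodule.Quotient.mk v, 0, fun h => hv (LieSubmodule.Quotient.mk_eq_zero'.mp h)⟩
    refine LieModule.IsIrreducible.mk fun K hK => ?_
    have hNK : N ≤ K.comap (LieSubmodule.Quotient.mk' N) := fun v hv => by
      rw [LieSubmodule.mem_comap, show LieSubmodule.Quotient.mk' N v = 0 from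
        LieSubmodule.Quotient.mk_eq_zero'.mpr hv]
      exact zero_mem K
    rcases hNK.eq_or_lt with h | h
    · refine absurd ((LieSubmodule.eq_bot_iff K).mpr fun q hq => ?_) hK
      obtain ⟨v, rfl⟩ := LieSubmodule.Quotient.surjective_mk' N q
      exact LieSubmodule.Quotient.mk_eq_zero'.mpr (h ▸ LieSubmodule.mem_comap.mpr hq)
    · have := hN.2 _ h
      rw [eq_top_iff]
      rintro q -
      obtain ⟨v, rfl⟩ := LieSubmodule.Quotient.surjective_mk' N q
      exact LieSubmodule.mem_comap.mp (this ▸ LieSubmodule.mem_top v)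
  have hzero : ∀ a ∈ LieAlgebra.radical ℂ L, ∀ v : M ⧸ N, ⁅a, v⁆ = 0 := by
    intro a ha v
    rw [← hR, ← LieSubmodule.mem_toSubmodule, LieSubmodule.lieIdeal_oper_eq_linear_span'] at ha
    induction ha using Submodule.span_induction with
    | zero => simp
    | add x y _ _ hx hy => rw [add_lie, hx, hy, add_zero]
    | smul r x _ hx => rw [smul_lie, hx, smul_zero]
    | mem z hz =>
      obtain ⟨x, -, a, ha, rfl⟩ := hz
      exact lie_lie_radical_eq_zero_of_isIrreducible x a ha v
  have hle : ⁅LieAlgebra.radical ℂ L, M⁆ ≤ N.map (LieSubmodule.incl M) := by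
    rw [LieSubmodule.lie_le_iff]
    intro a ha v hv
    refine (LieSubmodule.mem_map _).mpr ⟨⁅a, (⟨v, hv⟩ : M)⁆, ?_, rfl⟩
    have := hzero a ha (LieSubmodule.Quotient.mk' N ⟨v, hv⟩)
    rw [← LieModuleHom.map_lie] at this
    exact LieSubmodule.Quotient.mk_eq_zero'.mp this
  apply hN.1
  rw [eq_top_iff]
  rintro ⟨v, hv⟩ -
  obtain ⟨w, hw, hwv⟩ := (LieSubmodule.mem_map _).mp (hle (hM hv))
  have : w = ⟨v, hv⟩ := Subtype.ext hwv
  exact this ▸ hw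

end Perfect

/-! ### From subspaces to table entries -/

section Tables

variable {L : Type*} [LieRing L] [LieAlgebra ℂ L] {W : Fin 4 → Submodule ℂ L} {T : MultTable}

theorem entry_map {M : Type*} [AddCommGroup M] [Module ℂ M] (W : Fin 4 → Submodule ℂ M)
    (τ : Fin 4 → Fin 4) (x : Option (Fin 4)) :
    entry (fun i => W (τ i)) x = entry W (x.map τ) := by
  cases x <;> rfl

theorem entry_le_iSup_ne {M : Type*} [AddCommGroup M] [Module ℂ M] (W : Fin 4 → Submodule ℂ M)
    {x : Option (Fin 4)} {l : Fin 4} (h : x ≠ some l) : entry W x ≤ ⨆ i, ⨆ (_ : i ≠ l), W i := by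
  cases x with
  | none => exact bot_le
  | some a => exact le_iSup₂_of_le a (fun e => h (e ▸ rfl)) le_rfl

/-- Otherwise `W l` would lie in the sum of the other summands, against independence. -/
theorem eq_or_eq_of_le_entry_sup_entry {M : Type*} [AddCommGroup M] [Module ℂ M]
    {W : Fin 4 → Submodule ℂ M} (hind : iSupIndep W) (hne : ∀ i, W i ≠ ⊥)
    {x y : Option (Fin 4)} {l : Fin 4} (h : W l ≤ entry W x ⊔ entry W y) :
    x = some l ∨ y = some l := by
  by_contra! hxy
  exact hne l ((hind l).eq_bot_of_le
    (h.trans (sup_le (entry_le_iSup_ne W hxy.1) (entry_le_iSup_ne W hxy.2))))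

theorem entry_injective {M : Type*} [AddCommGroup M] [Module ℂ M]
    {W : Fin 4 → Submodule ℂ M} (hind : iSupIndep W) (hne : ∀ i, W i ≠ ⊥) :
    Function.Injective (entry W) := by
  rintro (_ | a) (_ | b) h
  · rfl
  · exact absurd h.symm (hne b)
  · exact absurd h (hne a)
  · exact congrArg some (hind.injective hne h)

theorem HasTable.symm (hT : HasTable W T) (hind : iSupIndep W) (hne : ∀ i, W i ≠ ⊥)
    (i j : Fin 4) : T i j = T j i :=
  entry_injective hind hne (by rw [← hT, ← hT, brac_comm])

theorem HasTable.lie_mem (hT : HasTable W T) {i j : Fin 4} {x y : L} (hx : x ∈ W i)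
    (hy : y ∈ W j) : ⁅x, y⁆ ∈ entry W (T i j) :=
  hT i j ▸ lie_mem_brac hx hy

theorem HasTable.brac_entry_left (hT : HasTable W T) (x : Option (Fin 4)) (j : Fin 4) :
    brac (entry W x) (W j) = entry W (x.bind fun a => T a j) := by
  cases x with
  | none => exact brac_bot_left _
  | some a => exact hT a j

theorem HasTable.brac_entry_right (hT : HasTable W T) (x : Option (Fin 4)) (i : Fin 4) :
    brac (W i) (entry W x) = entry W (x.bind fun a => T i a) := by
  cases x with
  | none => exact brac_bot_right _
  | some a => exact hT i a

/-- If `[[W i, W j], W h]` is `W l`, the Jacobi identity places `W l` inside the sum of two table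
entries, so one of them is `W l`. -/
theorem HasTable.jacobiTable (hT : HasTable W T) (hind : iSupIndep W) (hne : ∀ i, W i ≠ ⊥) :
    JacobiTable T := by
  intro i j h l hl
  apply eq_or_eq_of_le_entry_sup_entry hind hne
  have := brac_brac_le (W i) (W j) (W h)
  rwa [hT, hT, hT, hT.brac_entry_left, hT.brac_entry_left, hT.brac_entry_right, hl] at this

theorem HasTable.brac_iSup (hT : HasTable W T) :
    brac (⨆ i, W i) (⨆ i, W i) = ⨆ i, ⨆ j, entry W (T i j) := by
  simp only [brac_eq_map₂, Submodule.map₂_iSup_left, Submodule.map₂_iSup_right]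
  simp only [← brac_eq_map₂, hT _ _]
  exact iSup_comm

theorem exists_table (hconv : ∀ i j, brac (W i) (W j) ≠ ⊥ → ∃! l, brac (W i) (W j) = W l) :
    ∃ T : MultTable, HasTable W T := by
  have : ∀ i j, ∃ x, brac (W i) (W j) = entry W x := fun i j => by
    by_cases h : brac (W i) (W j) = ⊥
    · exact ⟨none, h⟩
    · obtain ⟨l, hl, -⟩ := hconv i j h
      exact ⟨some l, hl⟩
  choose T hT using this
  exact ⟨T, hT⟩

theorem exists_sum_eq {z : L} (hz : z ∈ ⨆ i, W i) : ∃ v : Fin 4 → L, (∀ i, v i ∈ W i) ∧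
    ∑ i, v i = z := by
  obtain ⟨f, hf, rfl⟩ := (Submodule.mem_iSup_iff_exists_finsupp W z).mp hz
  exact ⟨f, hf, (Finsupp.sum_fintype f (fun _ x => x) fun _ => rfl).symm⟩

end Tables

/-! ### Simple modules over the Levi subalgebra; derivations from gradings -/

section Levi

variable {g : Type*} [LieRing g] [LieAlgebra ℂ g] {gL : LieSubalgebra ℂ g}

theorem toSubmodule_ne_bot_of_isIrreducible {V : LieSubmodule ℂ gL g}
    (h : LieModule.IsIrreducible ℂ gL V) : V.toSubmodule ≠ ⊥ := by
  intro hV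
  have hV' : V = ⊥ := by rwa [← LieSubmodule.toSubmodule_eq_bot]
  subst hV'
  exact bot_ne_top (α := LieSubmodule ℂ gL (⊥ : LieSubmodule ℂ gL g)) (Subsingleton.elim _ _)

/-- An element of a simple submodule that kills another submodule is zero, unless the whole
product of the two submodules vanishes. -/
theorem eq_zero_of_forall_lie_eq_zero {U V : LieSubmodule ℂ gL g}
    (hU : LieModule.IsIrreducible ℂ gL U) (hne : brac U.toSubmodule V.toSubmodule ≠ ⊥)
    {z : g} (hz : z ∈ U) (h : ∀ w ∈ V, ⁅z, w⁆ = 0) : z = 0 := by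
  -- The annihilator of `V` in `U` is stable under `gL` because `V` is, so simplicity of `U` leaves
  -- only two cases.
  let K : LieSubmodule ℂ gL U :=
    { carrier := {u | ∀ w ∈ V, ⁅(u : g), w⁆ = 0}
      zero_mem' := fun w _ => by simp
      add_mem' := fun {a b} ha hb w hw => by
        change ⁅(a : g) + b, w⁆ = 0
        rw [add_lie, ha w hw, hb w hw, add_zero]
      smul_mem' := fun r a ha w hw => by
        change ⁅r • (a : g), w⁆ = 0
        rw [smul_lie, ha w hw, smul_zero]
      lie_mem := fun {s a} ha w hw => by
        change ⁅⁅(s : g), (a : g)⁆, w⁆ = 0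
        have h1 := ha ⁅(s : g), w⁆ (V.lie_mem (x := s) hw)
        rw [lie_lie, ha w hw, h1, lie_zero, sub_zero] }
  rcases eq_bot_or_eq_top K with hK | hK
  · have : (⟨z, hz⟩ : U) ∈ K := h
    rw [hK, LieSubmodule.mem_bot] at this
    exact congrArg Subtype.val this
  · refine absurd (le_bot_iff.mp (brac_le.mpr fun u hu w hw => ?_)) hne
    have : (⟨u, hu⟩ : U) ∈ K := hK ▸ LieSubmodule.mem_top _
    exact (Submodule.mem_bot ℂ).mpr (this w hw)

theorem eq_zero_of_forall_lie_eq_zero_of_isSimple (hsimple : LieAlgebra.IsSimple ℂ gL) {s : g}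
    (hs : s ∈ gL) (h : ∀ y ∈ gL, ⁅s, y⁆ = 0) : s = 0 := by
  have hc : (⟨s, hs⟩ : gL) ∈ LieAlgebra.center ℂ gL := by
    refine (LieModule.mem_maxTrivSubmodule (R := ℂ) (L := gL) (M := gL) _).mpr fun y => ?_
    apply Subtype.ext
    change ⁅(y : g), s⁆ = 0
    rw [← lie_skew, h y y.2, neg_zero]
  rw [LieAlgebra.center_eq_bot, LieSubmodule.mem_bot] at hc
  exact congrArg Subtype.val hc

variable {V : Fin 4 → LieSubmodule ℂ gL g} {T : MultTable}

/-- If all but one of the components that a product with `V j` can bring into `V l` vanish, then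
so does the last one, in an element that kills `V j`. -/
theorem component_eq_zero (hVsimple : ∀ i, LieModule.IsIrreducible ℂ gL (V i))
    (hVindep : iSupIndep fun i => (V i).toSubmodule)
    (hT : HasTable (fun i => (V i).toSubmodule) T) {z : Fin 4 → g} (hz : ∀ i, z i ∈ V i)
    (i j l : Fin 4) (hl : T i j = some l) (h : ∀ w ∈ V j, ⁅∑ i, z i, w⁆ = 0)
    (hz0 : ∀ i', i' ≠ i → T i' j = some l → z i' = 0) : z i = 0 := by
  have hV := fun i => toSubmodule_ne_bot_of_isIrreducible (hVsimple i)
  refine eq_zero_of_forall_lie_eq_zero (hVsimple i) (V := V j) ?_ (hz i) fun w hw => ?_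
  · have := hT i j
    rw [hl] at this
    exact this ▸ hV l
  · have h1 : ⁅z i, w⁆ ∈ (V l).toSubmodule := by
      have := hT.lie_mem (hz i) hw
      rwa [hl] at this
    -- Each term on the right vanishes or lies in a summand other than `V l`, while the left side
    -- lies in `V l`.
    have h2 : ⁅z i, w⁆ = -∑ i' ∈ Finset.univ.erase i, ⁅z i', w⁆ := by
      rw [eq_neg_iff_add_eq_zero, Finset.add_sum_erase _ (fun i => ⁅z i, w⁆) (Finset.mem_univ i),
        ← sum_lie, h w hw]
    refine Submodule.disjoint_def.mp (hVindep l) _ h1 (h2 ▸ neg_mem (sum_mem fun i' hi' => ?_))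
    by_cases hi : T i' j = some l
    · rw [hz0 i' (Finset.ne_of_mem_erase hi') hi, zero_lie]
      exact zero_mem _
    · exact entry_le_iSup_ne _ hi (hT.lie_mem (hz i') hw)

/-- The linear map acting by `0` on the Levi subalgebra and by a scalar on each summand of the
radical. -/
theorem exists_linearMap_smul (hLevi : IsCompl gL.toSubmodule (LieAlgebra.radical ℂ g).toSubmodule)
    (hVindep : iSupIndep fun i => (V i).toSubmodule)
    (hVsum : ⨆ i, (V i).toSubmodule = (LieAlgebra.radical ℂ g).toSubmodule) (c : Fin 4 → ℂ) :
    ∃ D : g →ₗ[ℂ] g, (∀ x ∈ gL, D x = 0) ∧ ∀ i, ∀ v ∈ V i, D v = c i • v := by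
  -- `P` recovers the components in the `V i` of an element of their direct sum.
  obtain ⟨P, hP⟩ := LinearMap.exists_leftInverse_of_injective
    (DFinsupp.lsum ℕ fun i => (V i).toSubmodule.subtype)
    (LinearMap.ker_eq_bot.mpr hVindep.dfinsupp_lsum_injective)
  refine ⟨(DFinsupp.lsum ℕ fun i => c i • (V i).toSubmodule.subtype) ∘ₗ P ∘ₗ
    Submodule.projection _ _ hLevi.symm, fun x hx => ?_, fun i v hv => ?_⟩
  · rw [LinearMap.comp_apply, LinearMap.comp_apply,
      (Submodule.projection_apply_eq_zero_iff hLevi.symm).mpr hx, map_zero, map_zero]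
  · have hr : v ∈ (LieAlgebra.radical ℂ g).toSubmodule :=
      hVsum ▸ Submodule.mem_iSup_of_mem i hv
    have hPv : P v = DFinsupp.single i ⟨v, hv⟩ := by
      simpa using LinearMap.congr_fun hP (DFinsupp.single i ⟨v, hv⟩)
    rw [LinearMap.comp_apply, LinearMap.comp_apply,
      Submodule.projection_apply_of_mem_left hLevi.symm hr, hPv]
    simp

/-- The Leibniz rule is bilinear and compatible with skew symmetry, so it need only be checked on
pairs from `gL` and the `V i`. Here `gL` has weight `0` and preserves each `V i`; for two summands
the rule is additivity of the weights. -/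
theorem exists_derivation (hLevi : IsCompl gL.toSubmodule (LieAlgebra.radical ℂ g).toSubmodule)
    (hVindep : iSupIndep fun i => (V i).toSubmodule)
    (hVsum : ⨆ i, (V i).toSubmodule = (LieAlgebra.radical ℂ g).toSubmodule)
    (hT : HasTable (fun i => (V i).toSubmodule) T) {c : Fin 4 → ℂ} (hc : IsGrading T c) :
    ∃ D : LieDerivation ℂ g g, (∀ x ∈ gL, D x = 0) ∧ ∀ i, ∀ v ∈ V i, D v = c i • v := by
  obtain ⟨D, hD0, hD⟩ := exists_linearMap_smul hLevi hVindep hVsum c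
  have key : ∀ x y : g, D ⁅x, y⁆ = ⁅x, D y⁆ - ⁅y, D x⁆ := by
    have skew : ∀ x y : g, D ⁅x, y⁆ = ⁅x, D y⁆ - ⁅y, D x⁆ → D ⁅y, x⁆ = ⁅y, D x⁆ - ⁅x, D y⁆ :=
      fun x y h => by rw [← lie_skew, map_neg, h, neg_sub]
    have add : ∀ x y y' : g, D ⁅x, y⁆ = ⁅x, D y⁆ - ⁅y, D x⁆ → D ⁅x, y'⁆ = ⁅x, D y'⁆ - ⁅y', D x⁆ →
        D ⁅x, y + y'⁆ = ⁅x, D (y + y')⁆ - ⁅y + y', D x⁆ := fun x y y' h h' => by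
      rw [lie_add, map_add, h, h', map_add, lie_add, add_lie]; abel
    have ind : ∀ x : g, (∀ y ∈ gL, D ⁅x, y⁆ = ⁅x, D y⁆ - ⁅y, D x⁆) →
        (∀ i, ∀ y ∈ V i, D ⁅x, y⁆ = ⁅x, D y⁆ - ⁅y, D x⁆) →
        ∀ y, D ⁅x, y⁆ = ⁅x, D y⁆ - ⁅y, D x⁆ := by
      intro x h0 hV y
      have hy : y ∈ gL.toSubmodule ⊔ ⨆ i, (V i).toSubmodule := by
        rw [hVsum, hLevi.sup_eq_top]; trivial
      obtain ⟨s, hs, r, hr, rfl⟩ := Submodule.mem_sup.mp hy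
      refine add _ _ _ (h0 s hs) ?_
      clear hy
      induction hr using Submodule.iSup_induction' with
      | zero => simp
      | add y y' _ _ h h' => exact add _ _ _ h h'
      | mem i y hy => exact hV i y hy
    have mixed : ∀ i, ∀ x ∈ gL, ∀ y ∈ V i, D ⁅x, y⁆ = ⁅x, D y⁆ - ⁅y, D x⁆ := by
      intro i x hx y hy
      have : ⁅x, y⁆ ∈ V i := (V i).lie_mem (x := ⟨x, hx⟩) hy
      rw [hD i _ this, hD i y hy, hD0 x hx, lie_zero, sub_zero, lie_smul]
    intro x
    apply ind x
    · intro y hy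
      refine skew _ _ (ind y (fun x hx => ?_) (fun i x hx => mixed i y hy x hx) x)
      rw [hD0 _ (gL.lie_mem hy hx), hD0 x hx, hD0 y hy, lie_zero, lie_zero, sub_zero]
    · intro j y hy
      refine skew _ _ (ind y (fun x hx => skew _ _ (mixed j x hx y hy)) (fun i x hx => ?_) x)
      rw [hD i x hx, hD j y hy, lie_smul, lie_smul, ← lie_skew x y, smul_neg, sub_neg_eq_add,
        ← add_smul]
      have := hT.lie_mem hy hx
      cases hij : T j i with
      | none =>
        rw [hij] at this
        rw [(Submodule.mem_bot ℂ).mp this]; simp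
      | some l =>
        rw [hij] at this
        rw [add_comm, hc _ _ _ hij, hD l _ this]
  exact ⟨⟨D, key⟩, hD0, hD⟩

/-- Suppose `D = ad (s + r)` with `s` in `gL` and `r` in the radical. For `y` in `gL`, `[s, y] =
-[r, y]` lies in both complements, so `s` is central in `gL` and vanishes. By `hi`, `ad r` maps `V
i` into the sum of the other summands, so it cannot act there by `c i ≠ 0`. -/
theorem not_isInner (hsimple : LieAlgebra.IsSimple ℂ gL)
    (hLevi : IsCompl gL.toSubmodule (LieAlgebra.radical ℂ g).toSubmodule)
    (hVsimple : ∀ i, LieModule.IsIrreducible ℂ gL (V i))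
    (hVindep : iSupIndep fun i => (V i).toSubmodule)
    (hVsum : ⨆ i, (V i).toSubmodule = (LieAlgebra.radical ℂ g).toSubmodule)
    (hT : HasTable (fun i => (V i).toSubmodule) T) {c : Fin 4 → ℂ} {D : LieDerivation ℂ g g}
    (hD0 : ∀ x ∈ gL, D x = 0) (hD : ∀ i, ∀ v ∈ V i, D v = c i • v) {i : Fin 4} (hci : c i ≠ 0)
    (hi : ∀ j, T j i ≠ some i) : ¬ IsInner D := by
  rintro ⟨x, hx⟩
  have hxm : x ∈ gL.toSubmodule ⊔ (LieAlgebra.radical ℂ g).toSubmodule := by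
    rw [hLevi.sup_eq_top]; trivial
  obtain ⟨s, hs, r, hr, rfl⟩ := Submodule.mem_sup.mp hxm
  have hs0 : s = 0 := by
    refine eq_zero_of_forall_lie_eq_zero_of_isSimple hsimple hs fun y hy => ?_
    have h1 : ⁅s, y⁆ = -⁅r, y⁆ := by
      rw [eq_neg_iff_add_eq_zero, ← add_lie, ← hx, hD0 y hy]
    refine Submodule.disjoint_def.mp hLevi.disjoint _ (gL.lie_mem hs hy) (h1 ▸ neg_mem ?_)
    exact lie_mem_left ℂ g _ r y hr
  subst hs0
  obtain ⟨v, hv, hv0⟩ :=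
    Submodule.exists_mem_ne_zero_of_ne_bot (toSubmodule_ne_bot_of_isIrreducible (hVsimple i))
  have h1 : c i • v = ⁅r, v⁆ := by rw [← hD i v hv, hx, zero_add]
  refine smul_ne_zero hci hv0 (Submodule.disjoint_def.mp (hVindep i) _
    (Submodule.smul_mem _ _ hv) (h1 ▸ ?_))
  rw [← hVsum] at hr
  clear hx hxm h1
  induction hr using Submodule.iSup_induction' with
  | zero => simp
  | add y y' _ _ h h' => rw [add_lie]; exact add_mem h h'
  | mem j y hy => exact entry_le_iSup_ne _ (hi j) (hT.lie_mem hy hv)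

end Levi

/-! ### The six tables and the excluded ones -/

theorem HasTable.comp {L : Type*} [LieRing L] [LieAlgebra ℂ L] {W : Fin 4 → Submodule ℂ L}
    {T T' : MultTable} (hT : HasTable W T) (τ : Fin 4 → Fin 4)
    (h : ∀ i j, T (τ i) (τ j) = (T' i j).map τ) : HasTable (fun i => W (τ i)) T' := fun i j => by
  exact (hT _ _).trans (by rw [h, entry_map W τ])

instance (T : MultTable) (i j : Fin 4) (x : Option (Fin 4)) : Decidable (T i j = x) :=
  inferInstance

theorem sixTables_mem : ∀ (t : Fin 6) (i j : Fin 4), sixTables t i j = o ∨ sixTables t i j = p ∨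
    sixTables t i j = k := by
  decide +kernel

theorem sixTables_exists : ∀ t, (∃ i j, sixTables t i j = p) ∧ ∃ i j, sixTables t i j = k := by
  decide +kernel

theorem sixTables_last : ∀ t j, sixTables t 3 j = o := by
  decide +kernel

/-- Some product `V l` with a factor `V i` cannot be obtained, with the same second factor, from
another `V i'`, except for the indices `i'` in `R`. -/
def Eliminates (T : MultTable) (R : List (Fin 4)) (i : Fin 4) : Prop :=
  ∃ j l, T i j = some l ∧ ∀ i', i' ≠ i → T i' j = some l → i' ∈ R

instance (T : MultTable) (R : List (Fin 4)) (i : Fin 4) : Decidable (Eliminates T R i) := by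
  unfold Eliminates; infer_instance

/-- In each of the six tables the components other than the last can be eliminated one by one. -/
theorem sixTables_elimination : ∀ t : Fin 6, ∃ a b c : Fin 4,
    (∀ i : Fin 4, i = a ∨ i = b ∨ i = c ∨ i = 3) ∧ Eliminates (sixTables t) [] a ∧
    Eliminates (sixTables t) [a] b ∧ Eliminates (sixTables t) [a, b] c := by
  decide +kernel

variable {g : Type*} [LieRing g] [LieAlgebra ℂ g] {gL : LieSubalgebra ℂ g}
  {V : Fin 4 → LieSubmodule ℂ gL g}

theorem brac_radical_eq_of_sixTables
    (hVsum : ⨆ i, (V i).toSubmodule = (LieAlgebra.radical ℂ g).toSubmodule) {t : Fin 6}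
    (hT : HasTable (fun i => (V i).toSubmodule) (sixTables t)) :
    brac (LieAlgebra.radical ℂ g).toSubmodule (LieAlgebra.radical ℂ g).toSubmodule
      = (V 2).toSubmodule ⊔ (V 3).toSubmodule := by
  rw [← hVsum, hT.brac_iSup]
  apply le_antisymm
  · refine iSup₂_le fun i j => ?_
    rcases sixTables_mem t i j with h | h | h <;> rw [h]
    exacts [bot_le, le_sup_left, le_sup_right]
  · obtain ⟨⟨i, j, h⟩, ⟨i', j', h'⟩⟩ := sixTables_exists t
    exact sup_le (le_iSup₂_of_le i j (by rw [h]; exact le_rfl))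
      (le_iSup₂_of_le i' j' (by rw [h']; exact le_rfl))

/-- `sixTables_elimination` kills three components of a central element one after another; the zero
last row makes `V 3` central. -/
theorem centerOf_radical_eq_of_sixTables (hVsimple : ∀ i, LieModule.IsIrreducible ℂ gL (V i))
    (hVindep : iSupIndep fun i => (V i).toSubmodule)
    (hVsum : ⨆ i, (V i).toSubmodule = (LieAlgebra.radical ℂ g).toSubmodule) {t : Fin 6}
    (hT : HasTable (fun i => (V i).toSubmodule) (sixTables t)) :
    centerOf (LieAlgebra.radical ℂ g) = (V 3).toSubmodule := by
  have hVrad : ∀ {i v}, v ∈ V i → v ∈ LieAlgebra.radical ℂ g := fun {i v} hv => by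
    rw [← LieSubmodule.mem_toSubmodule, ← hVsum]
    exact Submodule.mem_iSup_of_mem i hv
  ext z
  rw [mem_centerOf]
  constructor
  · rintro ⟨hz, hcomm⟩
    rw [← LieSubmodule.mem_toSubmodule, ← hVsum] at hz
    obtain ⟨v, hv, rfl⟩ := exists_sum_eq hz
    obtain ⟨a, b, c, hall, ⟨j, l, hl, h⟩, ⟨j', l', hl', h'⟩, ⟨j'', l'', hl'', h''⟩⟩ :=
      sixTables_elimination t
    have elim := component_eq_zero hVsimple hVindep hT hv
    have ha : v a = 0 := elim a j l hl (fun w hw => hcomm w (hVrad hw))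
      fun i hi hil => absurd (h i hi hil) List.not_mem_nil
    have hb : v b = 0 := elim b j' l' hl' (fun w hw => hcomm w (hVrad hw))
      fun i hi hil => List.mem_singleton.mp (h' i hi hil) ▸ ha
    have hc : v c = 0 := elim c j'' l'' hl'' (fun w hw => hcomm w (hVrad hw)) fun i hi hil => by
      have := h'' i hi hil
      simp only [List.mem_cons, List.not_mem_nil, or_false] at this
      rcases this with rfl | rfl <;> assumption
    rw [Finset.sum_eq_single 3 (fun i _ hi => ?_) (by simp)]
    · exact hv 3
    · rcases hall i with rfl | rfl | rfl | rfl
      exacts [ha, hb, hc, absurd rfl hi]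
  · intro hz
    refine ⟨hVrad hz, fun y hy => ?_⟩
    rw [← LieSubmodule.mem_toSubmodule, ← hVsum] at hy
    induction hy using Submodule.iSup_induction' with
    | zero => simp
    | add y y' _ _ h h' => rw [lie_add, h, h', add_zero]
    | mem j y hy =>
      have := hT.lie_mem hz hy
      rw [sixTables_last] at this
      exact (Submodule.mem_bot ℂ).mp this

/-- The radical of a perfect Lie algebra acts nilpotently, so among any summands there is one
that is not a product involving those summands. -/
theorem exists_ne_of_nonempty [FiniteDimensional ℂ g] (hperf : IsPerfect g)
    (hLevi : IsCompl gL.toSubmodule (LieAlgebra.radical ℂ g).toSubmodule)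
    (hVsimple : ∀ i, LieModule.IsIrreducible ℂ gL (V i))
    (hVsum : ⨆ i, (V i).toSubmodule = (LieAlgebra.radical ℂ g).toSubmodule) {T : MultTable}
    (hT : HasTable (fun i => (V i).toSubmodule) T) (C : Finset (Fin 4)) (hC : C.Nonempty) :
    ∃ l ∈ C, ∀ i, ∀ j ∈ C, T i j ≠ some l := by
  -- Otherwise the ideal generated by the `V l` with `l ∈ C` is contained in its product with the
  -- radical, hence zero.
  by_contra! h
  have hM := eq_bot_of_le_lie_radical (hperf.lie_radical_eq gL hLevi)
    (LieSubmodule.lieSpan ℂ g {x : g | ∃ l ∈ C, x ∈ V l}) (by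
      rw [LieSubmodule.lieSpan_le]
      rintro x ⟨l, hl, hx⟩
      obtain ⟨i, j, hj, hij⟩ := h l hl
      have hle : brac (V i).toSubmodule (V j).toSubmodule ≤
          (⁅LieAlgebra.radical ℂ g, LieSubmodule.lieSpan ℂ g
            {x : g | ∃ l ∈ C, x ∈ V l}⁆).toSubmodule := by
        refine brac_le.mpr fun u hu w hw => LieSubmodule.lie_mem_lie ?_ ?_
        · rw [← LieSubmodule.mem_toSubmodule, ← hVsum]
          exact Submodule.mem_iSup_of_mem i hu
        · exact LieSubmodule.subset_lieSpan ⟨j, hj, hw⟩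
      have hbr := hT i j
      rw [hij] at hbr
      exact hle (hbr ▸ hx))
  obtain ⟨l, hl⟩ := hC
  obtain ⟨v, hv, hv0⟩ :=
    Submodule.exists_mem_ne_zero_of_ne_bot (toSubmodule_ne_bot_of_isIrreducible (hVsimple l))
  apply hv0
  have : v ∈ LieSubmodule.lieSpan ℂ g {x : g | ∃ l ∈ C, x ∈ V l} :=
    LieSubmodule.subset_lieSpan ⟨l, hl, hv⟩
  rwa [hM, LieSubmodule.mem_bot] at this

theorem exists_perm_hasTable [FiniteDimensional ℂ g] (hsymp : IsSympathetic g)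
    (hsimple : LieAlgebra.IsSimple ℂ gL)
    (hLevi : IsCompl gL.toSubmodule (LieAlgebra.radical ℂ g).toSubmodule)
    (hVsimple : ∀ i, LieModule.IsIrreducible ℂ gL (V i))
    (hVindep : iSupIndep fun i => (V i).toSubmodule)
    (hVsum : ⨆ i, (V i).toSubmodule = (LieAlgebra.radical ℂ g).toSubmodule) {T : MultTable}
    (hT : HasTable (fun i => (V i).toSubmodule) T) :
    ∃ (σ : Equiv.Perm (Fin 4)) (t : Fin 6),
      HasTable (fun i => (V (σ i)).toSubmodule) (sixTables t) := by
  have hV := fun i => toSubmodule_ne_bot_of_isIrreducible (hVsimple i)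
  obtain ⟨σ, hσ⟩ := exists_perm_lt T (hT.symm hVindep hV)
    (exists_ne_of_nonempty hsymp.perfect hLevi hVsimple hVsum hT)
  -- The entries are relabelled by `σ.symm` so that they index the reordered family.
  let T' : MultTable := fun i j => (T (σ i) (σ j)).map σ.symm
  have hmap : ∀ i j, T (σ i) (σ j) = (T' i j).map σ := fun i j => by simp [T']
  have hT' : HasTable (fun i => (V (σ i)).toSubmodule) T' := hT.comp σ hmap
  have hind' : iSupIndep fun i => (V (σ i)).toSubmodule := hVindep.comp σ.injective
  have hsum' : ⨆ i, (V (σ i)).toSubmodule = (LieAlgebra.radical ℂ g).toSubmodule := by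
    rw [← hVsum]; exact σ.iSup_comp (g := fun i => (V i).toSubmodule)
  have hlt : ∀ i j l, T' i j = some l → i < l ∧ j < l := fun i j l h =>
    hσ i j l (by rw [hmap, h]; rfl)
  rcases table_classification T' (hT'.symm hind' fun i => hV _)
    (hT'.jacobiTable hind' fun i => hV _) hlt with ⟨w, hw, hgr⟩ | ⟨τ, t, h⟩
  · have hgr' : IsGrading T' fun i => (w i : ℂ) := fun i j l h => by
      have := hgr i j l h
      change (w i : ℂ) + w j = w l
      exact_mod_cast this
    obtain ⟨D, hD0, hD⟩ := exists_derivation hLevi hind' hsum' hT' hgr'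
    -- Index `3` is last in the order, so no product with factor `3` is `3` again.
    exact absurd (hsymp.inner D) (not_isInner hsimple hLevi (fun i => hVsimple _) hind' hsum' hT'
      hD0 hD (i := 3) (by exact_mod_cast hw) fun j h => lt_irrefl _ (hlt j 3 3 h).2)
  · exact ⟨τ.trans σ, t, hT'.comp τ h⟩

theorem OtherTable.isGrading {T : MultTable} {c : Fin 4 → ℂ} (h : OtherTable T c) (r : ℂ) :
    IsGrading T fun i => r * c i := by
  suffices IsGrading T c from fun i j l hl => by rw [← mul_add, this i j l hl]
  intro i j l hl
  rcases h with ⟨b, rfl | rfl⟩ | ⟨a, b, rfl | rfl, rfl | rfl⟩ | _ | ⟨a, rfl | rfl⟩ | _ | _ | _ <;>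
    fin_cases i <;> fin_cases j <;> simp at hl <;> subst hl <;> simp <;> norm_num

/-- Supplies what `not_isInner` requires at index `3`. -/
theorem OtherTable.last {T : MultTable} {c : Fin 4 → ℂ} (h : OtherTable T c) :
    c 3 ≠ 0 ∧ ∀ j, T j 3 = none := by
  cases h <;> refine ⟨by simp, fun j => ?_⟩ <;> fin_cases j <;> rfl

end Sympathetic

/-! ### The main theorem -/

theorem mainTheorem8 {g : Type*} [LieRing g] [LieAlgebra ℂ g] [FiniteDimensional ℂ g]
    -- a simple Levi subalgebra
    (gL : LieSubalgebra ℂ g) (hsimple : LieAlgebra.IsSimple ℂ gL)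
    (hLevi : IsCompl gL.toSubmodule (LieAlgebra.radical ℂ g).toSubmodule)
    -- the radical is the direct sum of four simple modules over the Levi subalgebra
    (V : Fin 4 → LieSubmodule ℂ gL g)
    (hVsimple : ∀ i, LieModule.IsIrreducible ℂ gL (V i))
    (hVindep : iSupIndep fun i => (V i).toSubmodule)
    (hVsum : ⨆ i, (V i).toSubmodule = (LieAlgebra.radical ℂ g).toSubmodule)
    -- standing convention: a nonzero product of two of the summands is one of the summands
    (hconv : ∀ i j, Sympathetic.brac (V i).toSubmodule (V j).toSubmodule ≠ ⊥ →
      ∃! l, Sympathetic.brac (V i).toSubmodule (V j).toSubmodule = (V l).toSubmodule) :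
    (Sympathetic.IsSympathetic g →
      ∃ σ : Equiv.Perm (Fin 4),
        Sympathetic.brac (LieAlgebra.radical ℂ g).toSubmodule
            (LieAlgebra.radical ℂ g).toSubmodule
          = (V (σ 2)).toSubmodule ⊔ (V (σ 3)).toSubmodule ∧
        Sympathetic.centerOf (LieAlgebra.radical ℂ g) = (V (σ 3)).toSubmodule ∧
        ∃ t : Fin 6,
          Sympathetic.HasTable (fun i => (V (σ i)).toSubmodule) (Sympathetic.sixTables t)) ∧
    (Sympathetic.IsPerfect g →
      ∀ (T : Sympathetic.MultTable) (c : Fin 4 → ℂ), Sympathetic.OtherTable T c →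
        Sympathetic.HasTable (fun i => (V i).toSubmodule) T →
        ∀ r : ℂ, r ≠ 0 →
          ∃ D : LieDerivation ℂ g g,
            (∀ x ∈ gL, D x = 0) ∧ (∀ i, ∀ v ∈ V i, D v = (r * c i) • v) ∧
            ¬ Sympathetic.IsInner D) := by
  refine ⟨fun hsymp => ?_, fun _ T c hTc hT r hr => ?_⟩
  · obtain ⟨T, hT⟩ := Sympathetic.exists_table hconv
    obtain ⟨σ, t, hσ⟩ :=
      Sympathetic.exists_perm_hasTable hsymp hsimple hLevi hVsimple hVindep hVsum hT
    have hsum' : ⨆ i, (V (σ i)).toSubmodule = (LieAlgebra.radical ℂ g).toSubmodule := by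
      rw [← hVsum]; exact σ.iSup_comp (g := fun i => (V i).toSubmodule)
    exact ⟨σ, Sympathetic.brac_radical_eq_of_sixTables hsum' hσ,
      Sympathetic.centerOf_radical_eq_of_sixTables (fun i => hVsimple _)
        (hVindep.comp σ.injective) hsum' hσ, t, hσ⟩
  · obtain ⟨D, hD0, hD⟩ :=
      Sympathetic.exists_derivation hLevi hVindep hVsum hT (hTc.isGrading r)
    exact ⟨D, hD0, hD, Sympathetic.not_isInner hsimple hLevi hVsimple hVindep hVsum hT hD0 hD
      (i := 3) (mul_ne_zero hr hTc.last.1) fun j h => by simp [hTc.last.2 j] at h⟩
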